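/- Let $q$ be a prime power, $r\ge 2$ an even integer, $a\in\mathrm{GF}(q^2)^*$ and $b\in\mathrm{GF}(q^2)\setminus\mathrm{GF}(q)$. Suppose that either $q$ is odd and $4a^{q+1}+(b^q-b)^2$ is a non-zero square in $\mathrm{GF}(q)$, or $q=2^h$ is even and $\mathrm{Tr}_q\bigl(a^{q+1}/(b^q+b)^2\bigr)=1$, where $\mathrm{Tr}_q(x)=x+x^2+x^{2^2}+\dots+x^{2^{h-1}}$. In $\mathrm{PG}(r,q^2)$ with homogeneous coordinates $(X_0,\dots,X_r)$ and affine coordinates $x_i=X_i/X_0$ (for $X_0\neq0$), let $\mathcal B(a,b)$ be the set of affine points with $$x_r^q-x_r+a^q(x_1^{2q}+\dots+x_{r-1}^{2q})-a(x_1^2+\dots+x_{r-1}^2)=(b^q-b)(x_1^{q+1}+\dots+x_{r-1}^{q+1}),$$ and let $P_\infty=(0,\dots,0,1)$. For an integer $j\ge0$ let $\overline{\mathcal B}_j$ be the multiset of points of $\mathrm{PG}(r,q^2)$ in which the points of $\mathcal B(a,b)$ have multiplicity $1$, $P_\infty$ has multiplicity $j$, and all other points have multiplicity $0$. The characters of $\overline{\mathcal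 B}_j$ are its intersection numbers with hyperplanes, counted with multiplicity, and $N_k$ is the number of hyperplanes meeting it in exactly $k$ points. A code generated from $\overline{\mathcal B}_j$ is the row space of a matrix over $\mathrm{GF}(q^2)$ whose columns are coordinate vectors of the points of $\overline{\mathcal B}_j$, repeated according to multiplicity, in any order and with any normalization; its weight enumerator is $w(x)=\sum_iA_ix^i$, where $A_i$ is the number of codewords of weight $i$. (1) For every $j\ge0$, $\overline{\mathcal B}_j$ has $q^{2r-1}+j$ points and its set of characters is $$\{\,j,\; q^{2r-3}+j,\; q^{2r-3}-q^{r-2},\; q^{2r-3}-q^{r-2}+q^{r-1}\,\}.$$ A code generated from $\overline{\mathcal B}_j$ exists, and every such code $\mathcal C$ is a $[q^{2r-1}+j,\,r+1]_{q^2}$ code whose set of weights of non-zero codewords is $$\{\,q^{2r-1},\; q^{2r-1}-q^{2r-3},\; q^{2r-1}-q^{2r-3}+q^{r-2}+j,\; q^{2r-1}-q^{2r-3}+q^{r-2}-q^{r-1}+j\,\}.$$ (2) Let $j=q^{r-1}-q^{r-2}$. Every code generated from $\overline{\mathcal B}_j$ has weight enumerator $$1+(q^2-1)x^{q^{2r-1}}+\bigl(q^{2r}-q^2+q^{2r-1}(q^2-1)\bigr)x^{q^{2r-1}-q^{2r-3}}+(q^{2r}-q^{2r-1})(q^2-1)\,x^{q^{2r-1}-q^{2r-3}+q^{r-1}}.$$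 If moreover $r\ge4$, then $\overline{\mathcal B}_j$ has exactly the three distinct characters $q^{r-1}-q^{r-2}$, $q^{2r-3}-q^{r-2}+q^{r-1}$, $q^{2r-3}-q^{r-2}$, with $$N_{q^{r-1}-q^{r-2}}=1,\qquad N_{q^{2r-3}-q^{r-2}+q^{r-1}}=\frac{q^{2r}-1}{q^2-1}-1+q^{2r-1},\qquad N_{q^{2r-3}-q^{r-2}}=q^{2r}-q^{2r-1},$$ and the code has exactly the three distinct non-zero weights $q^{2r-1}$, $q^{2r-1}-q^{2r-3}$, $q^{2r-1}-q^{2r-3}+q^{r-1}$. (3) Let $j=q^{2r-3}-q^{r-2}$. Every code generated from $\overline{\mathcal B}_j$ has weight enumerator $$1+(q^{2r}-q^{2r-1}+1)(q^2-1)\,x^{q^{2r-1}}+(q^{2r}-q^2)\,x^{q^{2r-1}-q^{2r-3}}+q^{2r-1}(q^2-1)\,x^{q^{2r-1}-q^{r-1}}.$$ If moreover $r\ge4$, then $\overline{\mathcal B}_j$ has exactly the three distinct characters $2q^{2r-3}-q^{r-2}$, $q^{2r-3}-q^{r-2}+q^{r-1}$, $q^{2r-3}-q^{r-2}$, with $$N_{2q^{2r-3}-q^{r-2}}=\frac{q^{2r}-1}{q^2-1}-1,\qquad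 N_{q^{2r-3}-q^{r-2}+q^{r-1}}=q^{2r-1},\qquad N_{q^{2r-3}-q^{r-2}}=q^{2r}-q^{2r-1}+1,$$ and the code has exactly the three distinct non-zero weights $q^{2r-1}$, $q^{2r-1}-q^{2r-3}$, $q^{2r-1}-q^{r-1}$. -/

import Mathlib

open Polynomial
open scoped LinearAlgebra.Projectivization

/-- The absolute trace `x + x ^ 2 + x ^ (2 ^ 2) + ⋯ + x ^ (2 ^ (h - 1))` of an element `x` of
`GF(2 ^ h)`, written for an element `x` of an overfield. -/
def absTrace {F : Type*} [Field F] (h : ℕ) (x : F) : F :=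
  ∑ i ∈ Finset.range h, x ^ (2 ^ i)

/-- The hypothesis on `a, b ∈ F = GF(q²)`, where `K = GF(q)`: either `q` is odd and
`4 a ^ (q + 1) + (b ^ q - b) ^ 2` is a nonzero square of `GF(q)`, or `q = 2 ^ h` is even and
`a ^ (q + 1) / (b ^ q + b) ^ 2` has absolute trace `1`. -/
def DiscriminantCondition (K : Type*) {F : Type*} [Field K] [Field F] [Algebra K F]
    (q : ℕ) (a b : F) : Prop :=
  (Odd q ∧ ∃ t : K, t ≠ 0 ∧
    4 * a ^ (q + 1) + (b ^ q - b) ^ 2 = algebraMap K F (t ^ 2)) ∨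
  (∃ h : ℕ, q = 2 ^ h ∧ absTrace h (a ^ (q + 1) / (b ^ q + b) ^ 2) = 1)

/-- The set `B(a, b)` of points of `PG(r, q²)`. A point with homogeneous coordinates
`(X₀, …, X_r)` is affine when `X₀ ≠ 0`; its affine coordinates `x₁, …, x_r` are the entries
of its representative with `X₀ = 1`. The index set `Finset.Ioo 0 (Fin.last r)` is
`{1, …, r - 1}`. -/
def setB {F : Type*} [Field F] (q r : ℕ) (a b : F) : Set (ℙ F (Fin (r + 1) → F)) :=
  {P | ∃ (x : Fin (r + 1) → F) (hx : x ≠ 0), P = Projectivization.mk F x hx ∧ x 0 = 1 ∧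
    x (Fin.last r) ^ q - x (Fin.last r)
        + a ^ q * ∑ i ∈ Finset.Ioo 0 (Fin.last r), x i ^ (2 * q)
        - a * ∑ i ∈ Finset.Ioo 0 (Fin.last r), x i ^ 2
      = (b ^ q - b) * ∑ i ∈ Finset.Ioo 0 (Fin.last r), x i ^ (q + 1)}

/-- The point `P_∞ = (0, …, 0, 1)`. -/
def pointInfty (F : Type*) [Field F] (r : ℕ) : ℙ F (Fin (r + 1) → F) :=
  Projectivization.mk F (Pi.single (Fin.last r) 1) (by simp)

/-- The multiset consisting of the points of `B(a, b)`, each with multiplicity one, and of the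
point `P_∞` with multiplicity `j`. -/
noncomputable def multisetB {F : Type*} [Field F] [Finite F] (q r j : ℕ) (a b : F) :
    Multiset (ℙ F (Fin (r + 1) → F)) :=
  (Set.toFinite (setB q r a b)).toFinset.val + Multiset.replicate j (pointInfty F r)

/-- The hyperplanes of `PG(r, F)`: the `r`-dimensional subspaces of `F ^ (r + 1)`. -/
def IsHyperplane {F : Type*} [Field F] {r : ℕ} (H : Submodule F (Fin (r + 1) → F)) : Prop :=
  Module.finrank F H = r

open Classical in
/-- The number of points of the multiset `M` on the subspace `H`, with multiplicities. -/
noncomputable def interNumber {F : Type*} [Field F] {r : ℕ}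
    (M : Multiset (ℙ F (Fin (r + 1) → F))) (H : Submodule F (Fin (r + 1) → F)) : ℕ :=
  (M.filter (fun P => P.submodule ≤ H)).card

/-- The characters of `M`: the intersection numbers with hyperplanes. -/
def characters {F : Type*} [Field F] {r : ℕ}
    (M : Multiset (ℙ F (Fin (r + 1) → F))) : Set ℕ :=
  {k | ∃ H : Submodule F (Fin (r + 1) → F), IsHyperplane H ∧ interNumber M H = k}

/-- The number of hyperplanes which meet `M` in exactly `k` points. -/
noncomputable def hyperplaneCount {F : Type*} [Field F] {r : ℕ}
    (M : Multiset (ℙ F (Fin (r + 1) → F))) (k : ℕ) : ℕ :=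
  {H : Submodule F (Fin (r + 1) → F) | IsHyperplane H ∧ interNumber M H = k}.ncard

/-- `C` is a code generated from `M`: it is the row space of a matrix `G` whose columns are
coordinate vectors of the points of `M` (with multiplicities), in some order and with some
normalization. -/
def IsCodeFrom {F : Type*} [Field F] {r n : ℕ} (M : Multiset (ℙ F (Fin (r + 1) → F)))
    (C : Submodule F (Fin n → F)) : Prop :=
  ∃ (G : Matrix (Fin (r + 1)) (Fin n) F) (hG : ∀ i, G.col i ≠ 0),
    Multiset.map (fun i => Projectivization.mk F (G.col i) (hG i)) Finset.univ.val = M ∧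
    C = Submodule.span F (Set.range G.row)

open Classical in
/-- The set of the weights of the nonzero codewords of `C`. -/
def nonzeroWeights {F : Type*} [Field F] {n : ℕ} (C : Submodule F (Fin n → F)) : Set ℕ :=
  {w | ∃ c ∈ C, c ≠ 0 ∧ hammingNorm c = w}

open Classical in
/-- The number `A_i` of codewords of `C` of Hamming weight `i`. -/
noncomputable def weightCount {F : Type*} [Field F] {n : ℕ} (C : Submodule F (Fin n → F))
    (i : ℕ) : ℕ :=
  {c : Fin n → F | c ∈ C ∧ hammingNorm c = i}.ncard

/-- The weight enumerator `∑ i, A_i x ^ i` of `C`. -/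
noncomputable def weightEnumerator {F : Type*} [Field F] {n : ℕ}
    (C : Submodule F (Fin n → F)) : ℕ[X] :=
  ∑ i ∈ Finset.range (n + 1), weightCount C i • X ^ i

/-! Write `K = GF(q)` and `F = GF(q²)`. Apart from `x_r ^ q - x_r`, the equation of `B(a, b)` is a
sum of one-variable forms `a ^ q x ^ (2q) - (b ^ q - b) x ^ (q + 1) - a x ^ 2 = a ^ q (x ^ q - z₁
x)(x ^ q - z₂ x)`. The discriminant condition makes `z₁` and `z₂` distinct elements of norm one
(`exists_normOne_roots`), so each factor takes values on a `K`-line of `F` and the product is a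
hyperbolic plane over `K`. All terms lie on one common `K`-line `δK`, and dividing by `δ` turns the
equation into `τ(t) + ∑ uᵢ vᵢ = 0` over `K`, with `t = x_r` and `τ : F → K` linear and onto
(`exists_hyperbolic_coordinates`, `mem_setB_iff`).

A hyperplane through `P_∞`, other than the one at infinity, cuts out a cylinder with `q` points over
each point of its base. A hyperplane not through `P_∞` expresses `t` affinely in the other
coordinates; a translation absorbs the linear term, leaving an affine quadric `∑ uᵢ vᵢ = c`, whose
size depends only on whether `c = 0` (`card_hyperbolic`).

The weight of the codeword of a linear form is the size of the multiset minus its intersection with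
the kernel of the form. One identity, `sum_interNumber`, sums an arbitrary function of the
intersection number over all forms: an indicator yields the characters and hyperplane counts, a
monomial yields the weight enumerator. -/

/-! ### Frobenius and Artin–Schreier preliminaries. -/

/-- `X ^ q - X` has at most `q` roots, and the image of `K` already supplies `q` of them. -/
theorem mem_range_algebraMap_of_pow_card {K L : Type*} [Field K] [Finite K] [Field L] [Algebra K L]
    {y : L} (hy : y ^ Nat.card K = y) : y ∈ Set.range (algebraMap K L) := by
  classical
  have := Fintype.ofFinite K
  have hc : 1 < Nat.card K := Finite.one_lt_card
  have hne : (X ^ Nat.card K - X : L[X]) ≠ 0 := FiniteField.X_pow_card_sub_X_ne_zero L hc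
  have hsub : Finset.univ.image (algebraMap K L) ⊆ (X ^ Nat.card K - X : L[X]).roots.toFinset := by
    intro x hx
    obtain ⟨k, -, rfl⟩ := Finset.mem_image.1 hx
    rw [Multiset.mem_toFinset, mem_roots hne]
    simp [← map_pow, Nat.card_eq_fintype_card, FiniteField.pow_card]
  have heq := Finset.eq_of_subset_of_card_le hsub (by
    rw [Finset.card_image_of_injective _ (algebraMap K L).injective, Finset.card_univ,
      ← Nat.card_eq_fintype_card]
    exact (Multiset.toFinset_card_le _).trans ((card_roots' _).trans
      (FiniteField.X_pow_card_sub_X_natDegree_eq L hc).le))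
  have hmem : y ∈ (X ^ Nat.card K - X : L[X]).roots.toFinset := by
    rw [Multiset.mem_toFinset, mem_roots hne]
    simp [hy, -Nat.card_eq_fintype_card]
  rw [← heq] at hmem
  obtain ⟨k, -, hk⟩ := Finset.mem_image.1 hmem
  exact ⟨k, hk⟩

section Frobenius

variable {K F : Type*} [Field K] [Finite K] [Field F] [Algebra K F]

theorem add_pow_natCard (x y : F) :
    (x + y) ^ Nat.card K = x ^ Nat.card K + y ^ Nat.card K := by
  have := Fintype.ofFinite K
  rw [Nat.card_eq_fintype_card]
  exact map_add (FiniteField.frobeniusAlgHom K F) x y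

theorem sub_pow_natCard (x y : F) :
    (x - y) ^ Nat.card K = x ^ Nat.card K - y ^ Nat.card K := by
  have := Fintype.ofFinite K
  rw [Nat.card_eq_fintype_card]
  exact map_sub (FiniteField.frobeniusAlgHom K F) x y

theorem algebraMap_pow_natCard (k : K) :
    algebraMap K F k ^ Nat.card K = algebraMap K F k := by
  have := Fintype.ofFinite K
  rw [Nat.card_eq_fintype_card, ← map_pow, FiniteField.pow_card]

theorem pow_natCard_pow_natCard [Finite F] (hKF : Module.finrank K F = 2) (x : F) :
    (x ^ Nat.card K) ^ Nat.card K = x := by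
  have := Fintype.ofFinite K
  have := Fintype.ofFinite F
  have h := FiniteField.pow_card x
  rwa [Module.card_eq_pow_finrank (K := K), hKF, sq, pow_mul, ← Nat.card_eq_fintype_card] at h

end Frobenius

theorem pow_two_pow_eq_add_absTrace {L : Type*} [Field L] [CharP L 2] {w A : L}
    (hw : w ^ 2 = w + A) (n : ℕ) : w ^ 2 ^ n = w + absTrace n A := by
  induction n with
  | zero => simp [absTrace]
  | succ n ih =>
    rw [pow_succ', pow_mul, hw, add_pow_char_pow, ih, absTrace, absTrace, Finset.sum_range_succ]
    ring

/-- An element of absolute trace one in `GF(2 ^ h)` has the form `w ^ 2 + w` for some `w` in the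
quadratic extension, and `w` is moved by the Frobenius to `w + 1`. -/
theorem exists_artinSchreier_root {K F : Type*} [Field K] [Finite K] [Field F] [Finite F]
    [Algebra K F] (hKF : Module.finrank K F = 2) [CharP F 2] {h : ℕ} (hq : Nat.card K = 2 ^ h)
    {A : F} (hA : absTrace h A = 1) :
    ∃ w : F, w ^ 2 = w + A ∧ w ^ Nat.card K = w + 1 := by
  have := Fintype.ofFinite K
  have := Fintype.ofFinite F
  have : CharP (AlgebraicClosure F) 2 := charP_of_injective_algebraMap
    (algebraMap F (AlgebraicClosure F)).injective 2
  obtain ⟨w, hw⟩ := IsAlgClosed.exists_root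
    (X ^ 2 + C (-1) * X + C (-(algebraMap F (AlgebraicClosure F) A)) : (AlgebraicClosure F)[X])
    (by
      have := degree_quadratic (R := AlgebraicClosure F) (a := 1) (b := -1)
        (c := -(algebraMap F (AlgebraicClosure F) A)) one_ne_zero
      rw [C_1, one_mul] at this
      rw [this]
      norm_num)
  have hw2 : w ^ 2 = w + algebraMap F _ A := by
    simp only [IsRoot.def, eval_add, eval_pow, eval_X, eval_mul, eval_C] at hw
    linear_combination hw
  have htr : absTrace h (algebraMap F (AlgebraicClosure F) A) = 1 := by
    have := congrArg (algebraMap F (AlgebraicClosure F)) hA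
    simpa [absTrace] using this
  have h1 := pow_two_pow_eq_add_absTrace hw2 h
  rw [htr] at h1
  -- Two applications of `w ↦ w ^ q = w + 1` add `2 = 0`, so `w`, taken in the algebraic closure,
  -- lies in `F`.
  have h2 : w ^ Nat.card F = w := by
    have : Nat.card F = 2 ^ h * 2 ^ h := by
      rw [Nat.card_eq_fintype_card, Module.card_eq_pow_finrank (K := K), hKF,
        ← Nat.card_eq_fintype_card, hq, sq]
    rw [this, pow_mul, h1, add_pow_char_pow, h1, one_pow, add_assoc, CharTwo.add_self_eq_zero,
      add_zero]
  obtain ⟨v, rfl⟩ := mem_range_algebraMap_of_pow_card h2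
  refine ⟨v, (algebraMap F (AlgebraicClosure F)).injective ?_,
    (algebraMap F (AlgebraicClosure F)).injective ?_⟩
  · simpa using hw2
  · rw [hq]
    simpa using h1

/-! ### Reduction of the equation to a hyperbolic form over `K`. -/

section NormalForm

variable {K F : Type*} [Field K] [Finite K] [Field F] [Finite F] [Algebra K F]

/-- These are the roots of `a ^ q z ^ 2 - (b ^ q - b) z - a`. With `ε = b ^ q - b`, so that `ε ^ q =
-ε`, the norm of a root is computed from its explicit formula. -/
theorem exists_normOne_roots (hKF : Module.finrank K F = 2) {a b : F} (ha : a ≠ 0)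
    (hb : b ∉ Set.range (algebraMap K F)) (hab : DiscriminantCondition K (Nat.card K) a b) :
    ∃ z₁ z₂ : F, z₁ ≠ z₂ ∧ z₁ ^ Nat.card K * z₁ = 1 ∧ z₂ ^ Nat.card K * z₂ = 1 ∧
      a ^ Nat.card K * (z₁ + z₂) = b ^ Nat.card K - b ∧ a ^ Nat.card K * (z₁ * z₂) = -a := by
  have hbb : b ^ Nat.card K - b ≠ 0 := fun h =>
    hb (mem_range_algebraMap_of_pow_card (sub_eq_zero.1 h))
  have haq : a ^ Nat.card K ≠ 0 := pow_ne_zero _ ha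
  have haa := pow_natCard_pow_natCard hKF a
  have hε : (b ^ Nat.card K - b) ^ Nat.card K = -(b ^ Nat.card K - b) := by
    rw [sub_pow_natCard, pow_natCard_pow_natCard hKF]; ring
  have := Fintype.ofFinite K
  rcases hab with ⟨hodd, t, ht, hdisc⟩ | ⟨h, hq, htr⟩
  · have h2K : (2 : K) ≠ 0 := by
      refine Ring.two_ne_zero fun hc => ?_
      have := FiniteField.even_card_of_char_two hc
      rw [← Nat.card_eq_fintype_card] at this
      exact (Nat.not_even_iff_odd.2 hodd) (Nat.even_iff.2 this)
    have h2 : (2 : F) ≠ 0 := by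
      simpa only [map_ofNat, map_zero] using (algebraMap K F).injective.ne h2K
    have h2q : (2 : F) ^ Nat.card K = 2 := by
      simpa only [map_ofNat] using algebraMap_pow_natCard (F := F) (2 : K)
    have ht' : algebraMap K F t ≠ 0 := by simpa using ht
    have htq := algebraMap_pow_natCard (F := F) t
    rw [map_pow, pow_succ] at hdisc
    generalize algebraMap K F t = s at *
    generalize b ^ Nat.card K - b = ε at *
    -- Quadratic formula. As `s ^ q = s`, both norms equal `(s ^ 2 - ε ^ 2) / (4 a ^ (q + 1)) = 1`.
    refine ⟨(ε + s) / (2 * a ^ Nat.card K), (ε - s) / (2 * a ^ Nat.card K), ?_, ?_, ?_, ?_, ?_⟩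
    · intro h
      rw [div_left_inj' (mul_ne_zero h2 haq)] at h
      exact mul_ne_zero h2 ht' (by linear_combination h)
    · rw [div_pow, add_pow_natCard, mul_pow, haa, hε, htq, h2q]
      field_simp
      linear_combination -hdisc
    · rw [div_pow, sub_pow_natCard, mul_pow, haa, hε, htq, h2q]
      field_simp
      linear_combination -hdisc
    · field_simp
      ring
    · field_simp
      linear_combination hdisc
  · have hchar : ringChar K = 2 := by
      refine FiniteField.even_card_iff_char_two.2 ?_
      rw [← Nat.card_eq_fintype_card, hq]
      have hc : 1 < Nat.card K := Finite.one_lt_card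
      have : h ≠ 0 := by rintro rfl; rw [hq] at hc; simp at hc
      exact Nat.even_iff.1 ((Nat.even_pow.2 ⟨even_two, this⟩))
    have : CharP K 2 := ringChar.of_eq hchar
    have : CharP F 2 := charP_of_injective_algebraMap (algebraMap K F).injective 2
    obtain ⟨w, hw, hwq⟩ := exists_artinSchreier_root hKF hq htr
    rw [← CharTwo.sub_eq_add (b ^ _) b, pow_succ] at hw
    generalize b ^ Nat.card K - b = ε at *
    have h2 : (2 : F) = 0 := CharTwo.two_eq_zero
    have hw' : ε ^ 2 * (w * (w + 1)) = a ^ Nat.card K * a := by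
      field_simp at hw
      linear_combination hw + ε ^ 2 * w * h2
    -- Frobenius exchanges `w` and `w + 1`, so both norms equal `ε ^ 2 w (w + 1) / a ^ (q + 1) = 1`.
    refine ⟨ε * w / a ^ Nat.card K, ε * (w + 1) / a ^ Nat.card K, ?_, ?_, ?_, ?_, ?_⟩
    · intro h
      rw [div_left_inj' haq] at h
      exact hbb (by linear_combination -h)
    · rw [div_pow, mul_pow, haa, hε, hwq]
      field_simp
      linear_combination -hw' - a ^ Nat.card K * a * h2
    · rw [div_pow, mul_pow, add_pow_natCard, one_pow, haa, hε, hwq]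
      field_simp
      linear_combination -hw' - a ^ Nat.card K * a * h2 - ε ^ 2 * (w + 1) * h2
    · field_simp
      linear_combination w * h2
    · field_simp
      linear_combination hw' + a ^ Nat.card K * a * h2

/-- If `z` has norm one, then `x ^ q - z * x` takes its values on a line over `K`. -/
theorem exists_linear_factor (hKF : Module.finrank K F = 2) {b z : F}
    (hb : b ∉ Set.range (algebraMap K F)) (hz : z ^ Nat.card K * z = 1) :
    ∃ (v : F) (l : F →ₗ[K] K), v ≠ 0 ∧ ∀ x, x ^ Nat.card K - z * x = v * algebraMap K F (l x) := by
  have hL : ∃ x, x ^ Nat.card K - z * x ≠ 0 := by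
    by_contra! h
    have h1 : z = 1 := by simpa [sub_eq_zero, eq_comm (a := (1 : F))] using h 1
    exact hb (mem_range_algebraMap_of_pow_card (by simpa [h1, sub_eq_zero] using h b))
  -- Frobenius multiplies every value by the same constant `-z ^ q`, so quotients of values are
  -- fixed by it and lie in `K`.
  have hpow : ∀ x, (x ^ Nat.card K - z * x) ^ Nat.card K =
      -z ^ Nat.card K * (x ^ Nat.card K - z * x) := fun x => by
    rw [sub_pow_natCard, mul_pow, pow_natCard_pow_natCard hKF]
    linear_combination -x * hz
  obtain ⟨x₀, hx₀⟩ := hL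
  have hz0 : z ^ Nat.card K ≠ 0 := left_ne_zero_of_mul_eq_one hz
  have hex : ∀ x, ∃ k : K,
      x ^ Nat.card K - z * x = (x₀ ^ Nat.card K - z * x₀) * algebraMap K F k := fun x => by
    obtain ⟨k, hk⟩ := mem_range_algebraMap_of_pow_card (K := K)
      (y := (x ^ Nat.card K - z * x) / (x₀ ^ Nat.card K - z * x₀)) (by
        rw [div_pow, hpow, hpow, mul_div_mul_left _ _ (neg_ne_zero.2 hz0)])
    exact ⟨k, by rw [hk, mul_div_cancel₀ _ hx₀]⟩
  choose l hl using hex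
  refine ⟨_, ⟨⟨l, fun x y => ?_⟩, fun k x => ?_⟩, hx₀, hl⟩
  · refine (algebraMap K F).injective (mul_left_cancel₀ hx₀ ?_)
    rw [map_add, mul_add, ← hl, ← hl, ← hl, add_pow_natCard]
    ring
  · refine (algebraMap K F).injective (mul_left_cancel₀ hx₀ ?_)
    rw [smul_eq_mul, map_mul, RingHom.id_apply, mul_left_comm, ← hl, ← hl, Algebra.smul_def, mul_pow,
      algebraMap_pow_natCard]
    ring

theorem exists_hyperbolic_coordinates (hKF : Module.finrank K F = 2) {a b : F} (ha : a ≠ 0)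
    (hb : b ∉ Set.range (algebraMap K F)) (hab : DiscriminantCondition K (Nat.card K) a b) :
    ∃ (e : F ≃ₗ[K] K × K) (τ : F →ₗ[K] K) (δ : F), δ ≠ 0 ∧ Function.Surjective τ ∧
      (∀ y, y ^ Nat.card K - y = δ * algebraMap K F (τ y)) ∧
      ∀ x, a ^ Nat.card K * x ^ (2 * Nat.card K) - a * x ^ 2
          - (b ^ Nat.card K - b) * x ^ (Nat.card K + 1)
        = δ * algebraMap K F ((e x).1 * (e x).2) := by
  obtain ⟨z₁, z₂, hne, h₁, h₂, hadd, hmul⟩ := exists_normOne_roots hKF ha hb hab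
  obtain ⟨v₁, l₁, hv₁, hl₁⟩ := exists_linear_factor hKF hb h₁
  obtain ⟨v₂, l₂, hv₂, hl₂⟩ := exists_linear_factor hKF hb h₂
  have hinj : Function.Injective (l₁.prod l₂) := by
    rw [injective_iff_map_eq_zero]
    intro x hx
    have hx1 : l₁ x = 0 := congrArg Prod.fst hx
    have hx2 : l₂ x = 0 := congrArg Prod.snd hx
    have e1 := hl₁ x
    have e2 := hl₂ x
    rw [hx1, map_zero, mul_zero] at e1
    rw [hx2, map_zero, mul_zero] at e2
    exact (mul_eq_zero.1 (show (z₁ - z₂) * x = 0 by linear_combination e2 - e1)).resolve_left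
      (sub_ne_zero.2 hne)
  have : FiniteDimensional K F := Module.finite_of_finrank_pos (by omega)
  let e : F ≃ₗ[K] K × K := LinearEquiv.ofInjectiveOfFinrankEq (l₁.prod l₂) hinj (by simp [hKF])
  have he : ∀ x, e x = (l₁ x, l₂ x) := fun x => rfl
  set δ : F := a ^ Nat.card K * (v₁ * v₂) with hδ
  have hδ0 : δ ≠ 0 := mul_ne_zero (pow_ne_zero _ ha) (mul_ne_zero hv₁ hv₂)
  have hform : ∀ x, a ^ Nat.card K * x ^ (2 * Nat.card K) - a * x ^ 2
          - (b ^ Nat.card K - b) * x ^ (Nat.card K + 1)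
        = δ * algebraMap K F ((e x).1 * (e x).2) := fun x => by
    rw [he, map_mul, ← hadd, mul_comm 2, pow_mul, pow_succ]
    linear_combination a ^ Nat.card K * (x ^ Nat.card K - z₂ * x) * hl₁ x +
      a ^ Nat.card K * v₁ * algebraMap K F (l₁ x) * hl₂ x - x ^ 2 * hmul
  -- The form changes sign under Frobenius and takes the value `δ` at the point with coordinates
  -- `(1, 1)`. Hence `δK` also contains every `y ^ q - y`.
  have hδq : δ ^ Nat.card K = -δ := by
    have h := hform (e.symm (1, 1))
    simp only [LinearEquiv.apply_symm_apply, mul_one, map_one] at h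
    generalize e.symm (1, 1) = x at h
    rw [← h, mul_comm 2, pow_mul, pow_succ x (Nat.card K), sub_pow_natCard, sub_pow_natCard]
    simp only [mul_pow]
    rw [sub_pow_natCard, pow_right_comm _ 2, pow_right_comm x 2]
    simp only [pow_natCard_pow_natCard hKF]
    ring
  have hex : ∀ y : F, ∃ k : K, y ^ Nat.card K - y = δ * algebraMap K F k := fun y => by
    obtain ⟨k, hk⟩ := mem_range_algebraMap_of_pow_card (K := K)
      (y := (y ^ Nat.card K - y) / δ) (by
        rw [div_pow, hδq, sub_pow_natCard, pow_natCard_pow_natCard hKF, ← neg_sub, neg_div_neg_eq])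
    exact ⟨k, by rw [hk, mul_div_cancel₀ _ hδ0]⟩
  choose τ hτ using hex
  let τ' : F →ₗ[K] K := ⟨⟨τ, fun x y => by
    refine (algebraMap K F).injective (mul_left_cancel₀ hδ0 ?_)
    rw [map_add, mul_add, ← hτ, ← hτ, ← hτ, add_pow_natCard]
    ring⟩, fun k x => by
    refine (algebraMap K F).injective (mul_left_cancel₀ hδ0 ?_)
    rw [smul_eq_mul, map_mul, RingHom.id_apply, mul_left_comm, ← hτ, ← hτ, Algebra.smul_def, mul_pow,
      algebraMap_pow_natCard]
    ring⟩
  refine ⟨e, τ', δ, hδ0, LinearMap.surjective fun h => hb ?_, hτ, hform⟩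
  refine mem_range_algebraMap_of_pow_card (sub_eq_zero.1 ?_)
  rw [hτ, show τ b = 0 from LinearMap.congr_fun h b, map_zero, mul_zero]

end NormalForm

/-! ### Fibres of linear maps and affine hyperbolic quadrics. -/

section Counting

theorem card_fiber_mul_card {K V W : Type*} [Semiring K] [AddCommGroup V] [AddCommGroup W]
    [Module K V] [Module K W] [Finite V] [Finite W] (f : V →ₗ[K] W) (hf : Function.Surjective f)
    (w : W) : Nat.card {v // f v = w} * Nat.card W = Nat.card V := by
  have := Fintype.ofFinite W
  have h : ∀ w' : W, Nat.card {v // f v = w'} = Nat.card {v // f v = w} := fun w' =>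
    Nat.card_congr (AddMonoidHom.fiberEquivOfSurjective (f := f.toAddMonoidHom) hf w' w)
  rw [← Nat.card_congr (Equiv.sigmaFiberEquiv f), Nat.card_sigma, Finset.sum_congr rfl
    fun w' _ => h w', Finset.sum_const, Finset.card_univ, smul_eq_mul, mul_comm,
    Nat.card_eq_fintype_card]

theorem card_subtype_prod_eq_sum {α β : Type*} [Fintype α] [Finite β] (p : α × β → Prop) :
    Nat.card {x // p x} = ∑ a, Nat.card {b // p (a, b)} := by
  rw [Nat.card_congr (Equiv.subtypeProdEquivSigmaSubtype fun a b => p (a, b)), Nat.card_sigma]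

theorem dotProduct_surjective {K : Type*} [Field K] {m : ℕ} {u : Fin m → K} (hu : u ≠ 0) :
    Function.Surjective (dotProductEquiv K (Fin m) u) :=
  LinearMap.surjective fun h => hu ((dotProductEquiv K (Fin m)).map_eq_zero_iff.1 h)

theorem card_dotProduct_eq {K : Type*} [Field K] [Finite K] {n : ℕ} {u : Fin (n + 1) → K}
    (hu : u ≠ 0) (c : K) : Nat.card {v : Fin (n + 1) → K // u ⬝ᵥ v = c} = Nat.card K ^ n := by
  have h := card_fiber_mul_card _ (dotProduct_surjective hu) c
  rw [Nat.card_fun, Nat.card_fin, pow_succ] at h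
  exact Nat.eq_of_mul_eq_mul_right Nat.card_pos h

open Classical in
/-- The number of points of a hyperbolic quadric in its standard form. -/
theorem card_hyperbolic {K : Type*} [Field K] [Finite K] (n : ℕ) (c : K) :
    Nat.card {p : (Fin (n + 1) → K) × (Fin (n + 1) → K) // p.1 ⬝ᵥ p.2 = c} =
      Nat.card K ^ (2 * n + 1) - Nat.card K ^ n + if c = 0 then Nat.card K ^ (n + 1) else 0 := by
  have := Fintype.ofFinite K
  -- Each of the `q ^ (n + 1) - 1` nonzero first components leaves `q ^ n` second ones; the zero
  -- component leaves all of them or none.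
  rw [card_subtype_prod_eq_sum, Fintype.sum_eq_add_sum_compl 0, Finset.sum_congr rfl
    fun u hu => card_dotProduct_eq (by simpa using hu) c, Finset.sum_const, Finset.card_compl,
    Finset.card_singleton, Fintype.card_pi_const, ← Nat.card_eq_fintype_card, smul_eq_mul,
    Nat.sub_mul, one_mul, ← pow_add, add_comm, two_mul, add_right_comm]
  congr 1
  split_ifs with hc
  · rw [Nat.card_congr (Equiv.subtypeUnivEquiv fun v => by rw [hc]; exact zero_dotProduct v),
      Nat.card_fun, Nat.card_fin]
  · simp [Ne.symm hc]

end Counting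

/-! ### Point counts in affine coordinates, by position of the hyperplane. -/

section NormSum

variable {K F : Type*} [Field K] [Field F] [Algebra K F] (e : F ≃ₗ[K] K × K) (τ : F →ₗ[K] K)

/-- The orthogonal sum of `m` copies of the hyperbolic plane given by the coordinates `e`. -/
def hyperbolicSum {m : ℕ} (y : Fin m → F) : K := ∑ i, (e (y i)).1 * (e (y i)).2

/-- The translation vector, as a pair, which absorbs the linear term `τ (l ⬝ᵥ y)`. -/
def shiftPair {m : ℕ} (l : Fin m → F) : (Fin m → K) × (Fin m → K) :=
  (fun i => τ (l i * e.symm (0, 1)), fun i => τ (l i * e.symm (1, 0)))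

theorem trace_mul_eq (x y : F) :
    τ (x * y) = (e y).1 * τ (x * e.symm (1, 0)) + (e y).2 * τ (x * e.symm (0, 1)) := by
  conv_lhs => rw [← e.symm_apply_apply y,
    show e y = (e y).1 • ((1, 0) : K × K) + (e y).2 • ((0, 1) : K × K) by ext <;> simp]
  rw [map_add, map_smul, map_smul, mul_add, mul_smul_comm, mul_smul_comm, map_add, map_smul,
    map_smul, smul_eq_mul, smul_eq_mul]

theorem card_hyperbolicSum_add_linear {m : ℕ} (l : Fin m → F) (l₀ : F) :
    Nat.card {y : Fin m → F // τ (l₀ + l ⬝ᵥ y) + hyperbolicSum e y = 0} =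
      Nat.card {p : (Fin m → K) × (Fin m → K) //
        p.1 ⬝ᵥ p.2 = (shiftPair e τ l).1 ⬝ᵥ (shiftPair e τ l).2 - τ l₀} := by
  refine Nat.card_congr (Equiv.subtypeEquiv (((Equiv.piCongrRight fun _ => e.toEquiv).trans
    (Equiv.arrowProdEquivProdArrow (Fin m) (fun _ => K) (fun _ => K))).trans
      (Equiv.addRight (shiftPair e τ l))) fun y => ?_)
  -- The hyperbolic analogue of completing the square: `uv + uβ + vα + αβ = (u + α)(v + β)`. This is
  -- why `shiftPair` interchanges the two basis vectors.
  have key : hyperbolicSum e y + τ (l ⬝ᵥ y) +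
      (shiftPair e τ l).1 ⬝ᵥ (shiftPair e τ l).2 =
      ((fun i => (e (y i)).1) + (shiftPair e τ l).1) ⬝ᵥ
        ((fun i => (e (y i)).2) + (shiftPair e τ l).2) := by
    simp only [hyperbolicSum, dotProduct, map_sum, ← Finset.sum_add_distrib]
    refine Finset.sum_congr rfl fun i _ => ?_
    rw [trace_mul_eq e τ]
    simp only [shiftPair, Pi.add_apply]
    ring
  change _ ↔ ((fun i => (e (y i)).1) + (shiftPair e τ l).1) ⬝ᵥ
    ((fun i => (e (y i)).2) + (shiftPair e τ l).2) = _
  rw [← key, map_add]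
  constructor <;> intro h <;> linear_combination h

theorem natCard_eq_sq (hKF : Module.finrank K F = 2) : Nat.card F = Nat.card K ^ 2 := by
  have : FiniteDimensional K F := Module.finite_of_finrank_pos (by omega)
  rw [Module.natCard_eq_pow_finrank (K := K), hKF]

variable [Finite K] [Finite F]

theorem card_trace_eq (hτ : Function.Surjective τ) (hKF : Module.finrank K F = 2)
    (c : K) : Nat.card {x // τ x = c} = Nat.card K := by
  have h := card_fiber_mul_card τ hτ c
  rw [natCard_eq_sq (K := K) hKF, sq] at h
  exact Nat.eq_of_mul_eq_mul_right Nat.card_pos h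

/-- The condition `p` ignores the last coordinate, which has `q` admissible values over each `y`,
namely a fibre of `τ`. -/
theorem card_cylinder (hτ : Function.Surjective τ) (hKF : Module.finrank K F = 2)
    {m : ℕ} (p : (Fin m → F) → Prop) :
    Nat.card {x : (Fin m → F) × F // τ x.2 + hyperbolicSum e x.1 = 0 ∧ p x.1} =
      Nat.card {y // p y} * Nat.card K := by
  classical
  have := Fintype.ofFinite F
  rw [card_subtype_prod_eq_sum]
  have h : ∀ y : Fin m → F, Nat.card {s // τ s + hyperbolicSum e y = 0 ∧ p y} =
      if p y then Nat.card K else 0 := fun y => by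
    split_ifs with hp
    · rw [← card_trace_eq τ hτ hKF (-hyperbolicSum e y)]
      simp [hp, eq_neg_iff_add_eq_zero, -Nat.card_eq_fintype_card]
    · simp [hp]
  simp only [h]
  rw [← Finset.sum_filter, Finset.sum_const, smul_eq_mul, Nat.card_eq_fintype_card (α := {y // p y}),
    Fintype.card_subtype]

theorem card_affine (hτ : Function.Surjective τ) (hKF : Module.finrank K F = 2)
    (m : ℕ) :
    Nat.card {x : (Fin m → F) × F // τ x.2 + hyperbolicSum e x.1 = 0} =
      Nat.card K ^ (2 * m + 1) := by
  have h := card_cylinder e τ hτ hKF (m := m) fun _ => True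
  simp only [and_true] at h
  rw [h, Nat.card_congr (Equiv.subtypeUnivEquiv fun _ => trivial), Nat.card_fun, Nat.card_fin,
    natCard_eq_sq (K := K) hKF, ← pow_mul, ← pow_succ]

theorem card_affine_inter_vertical (hτ : Function.Surjective τ) (hKF : Module.finrank K F = 2)
    {n : ℕ} (w₀ : F) {l : Fin (n + 1) → F} (hl : l ≠ 0) :
    Nat.card {x : (Fin (n + 1) → F) × F // τ x.2 + hyperbolicSum e x.1 = 0 ∧
      w₀ + l ⬝ᵥ x.1 + 0 * x.2 = 0} = Nat.card K ^ (2 * n + 1) := by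
  simp only [zero_mul, add_zero]
  rw [card_cylinder e τ hτ hKF fun y => w₀ + l ⬝ᵥ y = 0]
  simp only [add_eq_zero_iff_eq_neg']
  rw [card_dotProduct_eq hl, natCard_eq_sq (K := K) hKF, ← pow_mul, ← pow_succ]

-- Since `s ≠ 0`, the hyperplane is a graph over the first component, and projecting along `P_∞`
-- gives a hyperbolic quadric.
open Classical in
omit [Finite F] in
theorem card_affine_inter_nonvertical {n : ℕ} (w₀ : F) (l : Fin (n + 1) → F) {s : F} (hs : s ≠ 0) :
    Nat.card {x : (Fin (n + 1) → F) × F // τ x.2 + hyperbolicSum e x.1 = 0 ∧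
      w₀ + l ⬝ᵥ x.1 + s * x.2 = 0} =
      Nat.card K ^ (2 * n + 1) - Nat.card K ^ n +
        if (shiftPair e τ (-s⁻¹ • l)).1 ⬝ᵥ (shiftPair e τ (-s⁻¹ • l)).2 + τ (s⁻¹ * w₀) = 0
          then Nat.card K ^ (n + 1) else 0 := by
  have hsolve : ∀ (y : Fin (n + 1) → F) (t : F),
      w₀ + l ⬝ᵥ y + s * t = 0 ↔ t = -(s⁻¹ * w₀) + (-s⁻¹ • l) ⬝ᵥ y := fun y t => by
    rw [smul_dotProduct, smul_eq_mul]
    constructor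
    · intro h
      field_simp
      linear_combination h
    · rintro rfl
      field_simp
      ring
  rw [← sub_neg_eq_add _ (τ (s⁻¹ * w₀)), ← map_neg, ← card_hyperbolic,
    ← card_hyperbolicSum_add_linear]
  refine Nat.card_congr ⟨fun x => ⟨x.1.1, ?_⟩, fun y => ⟨(y.1, -(s⁻¹ * w₀) + (-s⁻¹ • l) ⬝ᵥ y.1),
    y.2, (hsolve _ _).2 rfl⟩, fun x => ?_, fun y => rfl⟩
  · rw [← (hsolve _ _).1 x.2.2]
    exact x.2.1
  · ext1
    exact Prod.ext rfl ((hsolve _ _).1 x.2.2).symm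

/-- A sum over all linear forms, when the summand depends only on the position of the hyperplane:
at infinity, vertical, tangent or secant. -/
theorem sum_by_position (hτ : Function.Surjective τ) (hKF : Module.finrank K F = 2)
    [Fintype F] {R : Type*} [AddCommMonoid R] {m : ℕ}
    (c : (Fin m → F) → F → K) (f : F → (Fin m → F) → F → R) {A B C D : R}
    (hA : ∀ w₀, w₀ ≠ 0 → f w₀ 0 0 = A) (hB : ∀ w₀ l, l ≠ 0 → f w₀ l 0 = B)
    (hC : ∀ w₀ l s, s ≠ 0 → c l s + τ (s⁻¹ * w₀) = 0 → f w₀ l s = C)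
    (hD : ∀ w₀ l s, s ≠ 0 → c l s + τ (s⁻¹ * w₀) ≠ 0 → f w₀ l s = D) :
    ∑ s, ∑ l, ∑ w₀, f w₀ l s = f 0 0 0 + ((Nat.card K ^ 2 - 1) • A +
      (Nat.card K ^ (2 * m + 2) - Nat.card K ^ 2) • B +
      (Nat.card K ^ (2 * m + 1) * (Nat.card K ^ 2 - 1)) • C +
      ((Nat.card K ^ (2 * m + 2) - Nat.card K ^ (2 * m + 1)) * (Nat.card K ^ 2 - 1)) • D) := by
  classical
  have hF : Fintype.card F = Nat.card K ^ 2 := by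
    rw [← Nat.card_eq_fintype_card, natCard_eq_sq (K := K) hKF]
  -- For fixed `l` and `s`, varying `w₀` gives `q` tangent cases whatever the value of `c l s`, so
  -- that constant never has to be computed.
  have hcard : ∀ (l : Fin m → F) (s : F), s ≠ 0 → (Finset.univ.filter fun w₀ : F => c l s + τ (s⁻¹ * w₀) = 0).card = Nat.card K := by
    intro l s hs
    rw [← card_trace_eq τ hτ hKF (-c l s), ← Fintype.card_subtype, ← Nat.card_eq_fintype_card]
    exact Nat.card_congr (Equiv.subtypeEquiv (Equiv.mulLeft₀ s⁻¹ (inv_ne_zero hs)) fun w => by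
      rw [add_eq_zero_iff_eq_neg']; rfl)
  have hin : ∀ (l : Fin m → F) (s : F), s ≠ 0 →
      ∑ w₀, f w₀ l s = Nat.card K • C + (Nat.card K ^ 2 - Nat.card K) • D := by
    intro l s hs
    rw [← Finset.sum_filter_add_sum_filter_not Finset.univ (fun w₀ => c l s + τ (s⁻¹ * w₀) = 0),
      Finset.sum_congr rfl fun w₀ hw => hC w₀ l s hs (Finset.mem_filter.1 hw).2,
      Finset.sum_congr rfl fun w₀ hw => hD w₀ l s hs (Finset.mem_filter.1 hw).2,
      Finset.sum_const, Finset.sum_const, Finset.filter_not, Finset.card_sdiff_of_subset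
      (Finset.filter_subset _ _), hcard l s hs, Finset.card_univ, hF]
  rw [Fintype.sum_eq_add_sum_compl (0 : F), Finset.sum_congr (s₁ := {0}ᶜ) rfl fun s hs =>
    Finset.sum_congr rfl fun l _ => hin l s (by simpa using hs),
    Fintype.sum_eq_add_sum_compl (0 : Fin m → F), Finset.sum_congr (s₁ := {0}ᶜ) rfl fun l hl =>
    Finset.sum_congr rfl fun w₀ _ => hB w₀ l (by simpa using hl),
    Fintype.sum_eq_add_sum_compl (0 : F), Finset.sum_congr (s₁ := {0}ᶜ) rfl fun w₀ hw =>
    hA w₀ (by simpa using hw)]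
  simp only [Finset.sum_const, Finset.card_compl, Finset.card_singleton, Finset.card_univ,
    Fintype.card_pi_const, hF, ← mul_nsmul', smul_add]
  rw [add_assoc, add_assoc, add_assoc, add_assoc]
  congr 4
  · rw [Nat.sub_mul]
    ring_nf
  · ring_nf
  · rw [show Nat.card K ^ (2 * m + 2) - Nat.card K ^ (2 * m + 1) =
      Nat.card K ^ (2 * m) * (Nat.card K ^ 2 - Nat.card K) by rw [Nat.mul_sub]; ring_nf]
    ring_nf

end NormSum

/-! ### Hyperplanes as kernels of linear forms. -/

section Hyperplanes

variable {F : Type*} [Field F] {r : ℕ}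

/-- The kernel of the linear form with coefficient vector `w`. -/
def formKer (w : Fin (r + 1) → F) : Submodule F (Fin (r + 1) → F) :=
  LinearMap.ker (dotProductEquiv F (Fin (r + 1)) w)

theorem mem_formKer {w v : Fin (r + 1) → F} : v ∈ formKer w ↔ w ⬝ᵥ v = 0 := by
  simp [formKer]

theorem submodule_mk_le_formKer {w v : Fin (r + 1) → F} (hv : v ≠ 0) :
    (Projectivization.mk F v hv).submodule ≤ formKer w ↔ w ⬝ᵥ v = 0 := by
  rw [Projectivization.submodule_mk, Submodule.span_singleton_le_iff_mem, mem_formKer]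

theorem isHyperplane_formKer {w : Fin (r + 1) → F} (hw : w ≠ 0) : IsHyperplane (formKer w) := by
  have h := Module.Dual.finrank_ker_add_one_of_ne_zero
    (f := dotProductEquiv F (Fin (r + 1)) w) (by simpa using hw)
  rw [Module.finrank_fin_fun] at h
  exact Nat.succ_injective h

theorem formKer_eq_iff {H : Submodule F (Fin (r + 1) → F)} (hH : IsHyperplane H)
    {w : Fin (r + 1) → F} (hw : w ≠ 0) :
    formKer w = H ↔ dotProductEquiv F (Fin (r + 1)) w ∈ H.dualAnnihilator := by
  rw [Submodule.mem_dualAnnihilator]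
  constructor
  · rintro rfl v hv
    exact hv
  · intro h
    exact (Submodule.eq_of_le_of_finrank_eq (fun v hv => h v hv)
      (hH.trans (isHyperplane_formKer hw).symm)).symm

/-- The forms with kernel `H` are the nonzero vectors of its annihilator, which is a line. -/
theorem card_formKer_eq [Finite F] {H : Submodule F (Fin (r + 1) → F)} (hH : IsHyperplane H) :
    Nat.card {w : Fin (r + 1) → F // w ≠ 0 ∧ formKer w = H} = Nat.card F - 1 := by
  classical
  have hrank : Module.finrank F H.dualAnnihilator = 1 := by
    have h := Subspace.finrank_add_finrank_dualAnnihilator_eq H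
    rw [Module.finrank_fin_fun, show Module.finrank F H = r from hH] at h
    omega
  have : Finite (Module.Dual F (Fin (r + 1) → F)) :=
    Finite.of_equiv _ (dotProductEquiv F (Fin (r + 1))).toEquiv
  have := Fintype.ofFinite H.dualAnnihilator
  have hcard : Nat.card H.dualAnnihilator = Nat.card F := by
    rw [Module.natCard_eq_pow_finrank (K := F), hrank, pow_one]
  rw [← hcard, Nat.card_eq_fintype_card (α := H.dualAnnihilator),
    ← Set.card_ne_eq (0 : H.dualAnnihilator), ← Nat.card_eq_fintype_card]
  refine Nat.card_congr
    ⟨fun w => ⟨⟨dotProductEquiv F _ w.1, (formKer_eq_iff hH w.2.1).1 w.2.2⟩, ?_⟩,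
     fun f => ⟨(dotProductEquiv F _).symm f.1.1, ?_, ?_⟩, fun w => ?_, fun f => ?_⟩
  · intro h
    exact w.2.1 ((dotProductEquiv F _).map_eq_zero_iff.1 (congrArg Subtype.val h))
  · intro h
    exact f.2 (Subtype.ext ((dotProductEquiv F _).symm.map_eq_zero_iff.1 h))
  · rw [formKer_eq_iff hH, LinearEquiv.apply_symm_apply]
    · exact f.1.2
    · intro h
      exact f.2 (Subtype.ext ((dotProductEquiv F _).symm.map_eq_zero_iff.1 h))
  · simp
  · simp

theorem exists_formKer_eq [Finite F] {H : Submodule F (Fin (r + 1) → F)} (hH : IsHyperplane H) :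
    ∃ w, w ≠ 0 ∧ formKer w = H := by
  have h := card_formKer_eq hH
  have h1 : 1 < Nat.card F := Finite.one_lt_card
  have : Nonempty {w : Fin (r + 1) → F // w ≠ 0 ∧ formKer w = H} :=
    (Nat.card_pos_iff.1 (by omega)).1
  obtain ⟨w, hw⟩ := this
  exact ⟨w, hw⟩

theorem characters_eq [Finite F] (M : Multiset (ℙ F (Fin (r + 1) → F))) :
    characters M = {k | ∃ w, w ≠ 0 ∧ interNumber M (formKer w) = k} := by
  ext k
  constructor
  · rintro ⟨H, hH, rfl⟩
    obtain ⟨w, hw, rfl⟩ := exists_formKer_eq hH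
    exact ⟨w, hw, rfl⟩
  · rintro ⟨w, hw, rfl⟩
    exact ⟨_, isHyperplane_formKer hw, rfl⟩

open Classical in
theorem card_sub_one_mul_hyperplaneCount [Fintype F] (M : Multiset (ℙ F (Fin (r + 1) → F)))
    (k : ℕ) :
    (Nat.card F - 1) * hyperplaneCount M k =
      (Finset.univ.filter fun w : Fin (r + 1) → F =>
        w ≠ 0 ∧ interNumber M (formKer w) = k).card := by
  have hfin : {H : Submodule F (Fin (r + 1) → F) | IsHyperplane H ∧ interNumber M H = k}.Finite :=
    Set.toFinite _
  rw [hyperplaneCount, Set.ncard_eq_toFinset_card _ hfin,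
    Finset.card_eq_sum_card_fiberwise (f := formKer) (t := hfin.toFinset), mul_comm,
    Finset.sum_const_nat]
  · intro H hH
    rw [Set.Finite.mem_toFinset] at hH
    rw [← card_formKer_eq hH.1, Finset.filter_filter, ← Fintype.card_subtype,
      ← Nat.card_eq_fintype_card]
    refine Nat.card_congr (Equiv.subtypeEquivRight fun w => ⟨fun h => ⟨h.1.1, h.2⟩, fun h =>
      ⟨⟨h.1, h.2 ▸ hH.2⟩, h.2⟩⟩)
  · intro w hw
    have hw' := (Finset.mem_filter.1 hw).2
    simpa using ⟨isHyperplane_formKer hw'.1, hw'.2⟩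

end Hyperplanes

/-! ### Codeword weights from intersection numbers. -/

section Codes

variable {F : Type*} [Field F] {r n : ℕ}

theorem card_eq_of_isCodeFrom {M : Multiset (ℙ F (Fin (r + 1) → F))} {C : Submodule F (Fin n → F)}
    (hC : IsCodeFrom M C) : n = M.card := by
  obtain ⟨G, hG, rfl, -⟩ := hC
  simp

theorem exists_isCodeFrom (M : Multiset (ℙ F (Fin (r + 1) → F))) (hn : M.card = n) :
    ∃ C : Submodule F (Fin n → F), IsCodeFrom M C := by
  obtain ⟨L, rfl⟩ : ∃ L : List (ℙ F (Fin (r + 1) → F)), (L : Multiset _) = M :=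
    Quotient.exists_rep M
  obtain rfl : L.length = n := hn
  refine ⟨_, Matrix.of fun i k => (L.get k).rep i, fun k => (L.get k).rep_nonzero, ?_, rfl⟩
  have : (fun k : Fin L.length => Projectivization.mk F
      ((Matrix.of fun i (k : Fin L.length) => (L.get k).rep i).col k) (L.get k).rep_nonzero) =
      L.get := funext fun k => (L.get k).mk_rep
  rw [this, Fin.univ_val_map, List.ofFn_get]

-- A coordinate of the codeword vanishes exactly when the corresponding point lies on the kernel of
-- `w`.
open Classical in
theorem hammingNorm_vecMul {M : Multiset (ℙ F (Fin (r + 1) → F))}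
    {G : Matrix (Fin (r + 1)) (Fin n) F} (hG : ∀ i, G.col i ≠ 0)
    (hM : Multiset.map (fun i => Projectivization.mk F (G.col i) (hG i)) Finset.univ.val = M)
    (w : Fin (r + 1) → F) :
    hammingNorm (Matrix.vecMul w G) = M.card - interNumber M (formKer w) := by
  subst hM
  rw [interNumber, Multiset.filter_map, Multiset.card_map, Multiset.card_map]
  have h := Finset.card_filter_add_card_filter_not (s := (Finset.univ : Finset (Fin n)))
    fun i => Matrix.vecMul w G i = 0
  have h2 : (Multiset.filter ((fun P : ℙ F (Fin (r + 1) → F) => P.submodule ≤ formKer w) ∘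
      fun i => Projectivization.mk F (G.col i) (hG i)) Finset.univ.val).card =
      (Finset.univ.filter fun i => Matrix.vecMul w G i = 0).card := by
    rw [Finset.card_def, Finset.filter_val]
    congr 1
    refine Multiset.filter_congr fun i _ => ?_
    rw [Function.comp_apply, submodule_mk_le_formKer]
    rfl
  rw [hammingNorm, ← Finset.card_def]
  exact Nat.eq_sub_of_add_eq' ((congrArg (· + _) h2).trans h)

variable {M : Multiset (ℙ F (Fin (r + 1) → F))}

-- Encoding is injective because no hyperplane contains the whole multiset: a nonzero form never
-- gives the zero word.
open Classical in
theorem exists_encoder {C : Submodule F (Fin n → F)} (hC : IsCodeFrom M C)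
    (hM : ∀ w, w ≠ 0 → interNumber M (formKer w) < M.card) :
    ∃ φ : (Fin (r + 1) → F) →ₗ[F] (Fin n → F), Function.Injective φ ∧ LinearMap.range φ = C ∧
      ∀ w, hammingNorm (φ w) = M.card - interNumber M (formKer w) := by
  obtain ⟨G, hG, hMG, rfl⟩ := hC
  refine ⟨G.vecMulLinear, ?_, range_vecMulLinear G, hammingNorm_vecMul hG hMG⟩
  rw [injective_iff_map_eq_zero]
  intro w hw
  by_contra hne
  have h := hammingNorm_vecMul hG hMG w
  have h0 : Matrix.vecMul w G = 0 := hw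
  rw [h0, hammingNorm_zero] at h
  have := hM w hne
  omega

theorem finrank_of_isCodeFrom {C : Submodule F (Fin n → F)} (hC : IsCodeFrom M C)
    (hM : ∀ w, w ≠ 0 → interNumber M (formKer w) < M.card) : Module.finrank F C = r + 1 := by
  obtain ⟨φ, hφ, rfl, -⟩ := exists_encoder hC hM
  rw [LinearMap.finrank_range_of_inj hφ, Module.finrank_fin_fun]

theorem nonzeroWeights_eq {C : Submodule F (Fin n → F)} (hC : IsCodeFrom M C)
    (hM : ∀ w, w ≠ 0 → interNumber M (formKer w) < M.card) :
    nonzeroWeights C = (fun k => M.card - k) '' {k | ∃ w, w ≠ 0 ∧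
      interNumber M (formKer w) = k} := by
  classical
  obtain ⟨φ, hφ, rfl, hw⟩ := exists_encoder hC hM
  ext k
  constructor
  · rintro ⟨c, ⟨w, rfl⟩, hc, rfl⟩
    refine ⟨_, ⟨w, ?_, rfl⟩, ?_⟩
    · rintro rfl
      exact hc (map_zero φ)
    · convert (hw w).symm
  · rintro ⟨_, ⟨w, hw0, rfl⟩, rfl⟩
    refine ⟨φ w, ⟨w, rfl⟩, fun h => hw0 (hφ (h.trans (map_zero φ).symm)), ?_⟩
    convert hw w

theorem weightEnumerator_eq_sum [Fintype F] {C : Submodule F (Fin n → F)} (hC : IsCodeFrom M C)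
    (hM : ∀ w, w ≠ 0 → interNumber M (formKer w) < M.card) :
    weightEnumerator C = ∑ w, X ^ (M.card - interNumber M (formKer w)) := by
  classical
  obtain ⟨φ, hφ, rfl, hw⟩ := exists_encoder hC hM
  have hcount : ∀ i, weightCount (LinearMap.range φ) i =
      (Finset.univ.filter fun w => hammingNorm (φ w) = i).card := by
    intro i
    rw [weightCount, ← Finset.card_image_of_injective _ hφ, ← Set.ncard_coe_finset]
    congr 1
    ext c
    simp only [Set.mem_ofPred_eq, Finset.coe_image, Finset.coe_filter, Finset.mem_univ, true_and,
      Set.mem_image, LinearMap.mem_range]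
    constructor
    · rintro ⟨⟨w, rfl⟩, h⟩
      exact ⟨w, by convert h, rfl⟩
    · rintro ⟨w, h, rfl⟩
      exact ⟨⟨w, rfl⟩, by convert h⟩
  simp only [weightEnumerator, hcount, ← hw]
  rw [← Finset.sum_fiberwise_of_maps_to (s := Finset.univ) (t := Finset.range (n + 1))
    (g := fun w => hammingNorm (φ w))]
  · refine Finset.sum_congr rfl fun i _ => ?_
    rw [Finset.sum_congr rfl fun w hw' => by rw [(Finset.mem_filter.1 hw').2], Finset.sum_const]
  · intro w _
    rw [Finset.mem_range, Nat.lt_succ_iff]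
    exact hammingNorm_le_card_fintype.trans_eq (Fintype.card_fin n)

end Codes

/-! ### Splitting off the first and last homogeneous coordinates. -/

section Coordinates

/-- The coordinate vector `(x₀, y, t)` with first entry `x₀`, last entry `t` and middle part `y`. -/
def coordEquiv (F : Type*) (m : ℕ) : F × (Fin m → F) × F ≃ (Fin (m + 1 + 1) → F) where
  toFun x := Fin.cons x.1 (Fin.snoc x.2.1 x.2.2 : Fin (m + 1) → F)
  invFun v := (v 0, fun i => v i.castSucc.succ, v (Fin.last (m + 1)))
  left_inv x := by simp [← Fin.succ_last]
  right_inv v := by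
    refine funext fun i => Fin.cases rfl (fun j => ?_) i
    refine Fin.lastCases ?_ (fun k => ?_) j <;> simp

@[simp] theorem coordEquiv_zero {F : Type*} {m : ℕ} (x : F × (Fin m → F) × F) : coordEquiv F m x 0 = x.1 := rfl

@[simp] theorem coordEquiv_middle {F : Type*} {m : ℕ} (x : F × (Fin m → F) × F) (i : Fin m) :
    coordEquiv F m x i.castSucc.succ = x.2.1 i := by simp [coordEquiv]

@[simp] theorem coordEquiv_last {F : Type*} {m : ℕ} (x : F × (Fin m → F) × F) :
    coordEquiv F m x (Fin.last (m + 1)) = x.2.2 := by simp [coordEquiv, ← Fin.succ_last]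

theorem sum_Ioo_zero_last {R : Type*} [AddCommMonoid R] {m : ℕ} (f : Fin (m + 1 + 1) → R) :
    ∑ i ∈ Finset.Ioo 0 (Fin.last (m + 1)), f i = ∑ i : Fin m, f i.castSucc.succ := by
  have h : Finset.Ioo 0 (Fin.last (m + 1)) =
      Finset.univ.map ((Fin.castSuccEmb (n := m)).trans (Fin.succEmb (m + 1))) := by
    ext i
    refine Fin.cases (by simp [Fin.succ_ne_zero]) (fun j => ?_) i
    refine Fin.lastCases ?_ (fun k => ?_) j
    · simp [← Fin.succ_last, Fin.castSucc_ne_last]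
    · simp [← Fin.succ_last, Fin.castSucc_lt_last]
  rw [h, Finset.sum_map]
  rfl

theorem sum_coordEquiv {F : Type*} [Fintype F] {R : Type*} [AddCommMonoid R] {m : ℕ}
    (f : (Fin (m + 1 + 1) → F) → R) :
    ∑ w, f w = ∑ s, ∑ l, ∑ w₀, f (coordEquiv F m (w₀, l, s)) := by
  rw [← (coordEquiv F m).sum_comp, Fintype.sum_prod_type_right, Fintype.sum_prod_type_right]

variable {F : Type*} [Field F]

theorem coordEquiv_dotProduct {m : ℕ} (w x : F × (Fin m → F) × F) :
    coordEquiv F m w ⬝ᵥ coordEquiv F m x = w.1 * x.1 + w.2.1 ⬝ᵥ x.2.1 + w.2.2 * x.2.2 := by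
  rw [dotProduct, Fin.sum_univ_succ, Fin.sum_univ_castSucc]
  simp [dotProduct, add_assoc]

theorem coordEquiv_one_ne_zero {m : ℕ} (x : (Fin m → F) × F) : coordEquiv F m (1, x) ≠ 0 :=
  fun h => one_ne_zero (α := F) (congrFun h 0)

/-- The affine point with affine coordinates `(y, t)`. -/
def affinePoint {m : ℕ} (x : (Fin m → F) × F) : ℙ F (Fin (m + 1 + 1) → F) :=
  Projectivization.mk F (coordEquiv F m (1, x)) (coordEquiv_one_ne_zero x)

theorem affinePoint_injective {m : ℕ} :
    Function.Injective (affinePoint : (Fin m → F) × F → ℙ F (Fin (m + 1 + 1) → F)) := by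
  intro x y h
  obtain ⟨c, hc⟩ := (Projectivization.mk_eq_mk_iff' _ _ _ _ _).1 h
  have hc1 : c = 1 := by simpa using congrFun hc 0
  rw [hc1, one_smul, (coordEquiv F m).injective.eq_iff] at hc
  exact (congrArg Prod.snd hc).symm

theorem affinePoint_submodule_le_formKer {m : ℕ} (x : (Fin m → F) × F)
    (w : F × (Fin m → F) × F) : (affinePoint x).submodule ≤ formKer (coordEquiv F m w) ↔
      w.1 + w.2.1 ⬝ᵥ x.1 + w.2.2 * x.2 = 0 := by
  rw [affinePoint, submodule_mk_le_formKer, coordEquiv_dotProduct, mul_one]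

theorem pointInfty_submodule_le_formKer {m : ℕ} (w : F × (Fin m → F) × F) :
    (pointInfty F (m + 1)).submodule ≤ formKer (coordEquiv F m w) ↔ w.2.2 = 0 := by
  rw [pointInfty, submodule_mk_le_formKer]
  simp

theorem interNumber_multisetB [Finite F] {r : ℕ} (q j : ℕ) (a b : F)
    (H : Submodule F (Fin (r + 1) → F)) [Decidable ((pointInfty F r).submodule ≤ H)] :
    interNumber (multisetB q r j a b) H =
      Nat.card {P // P ∈ setB q r a b ∧ P.submodule ≤ H} +
        if (pointInfty F r).submodule ≤ H then j else 0 := by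
  classical
  rw [interNumber, multisetB, Multiset.filter_add, Multiset.card_add]
  congr 1
  · rw [← Finset.filter_val, ← Finset.card_def, ← Nat.card_eq_finsetCard]
    exact Nat.card_congr (Equiv.subtypeEquivRight fun P => by simp)
  · split_ifs with h
    · rw [Multiset.filter_eq_self.2 fun P hP => (Multiset.eq_of_mem_replicate hP) ▸ h,
        Multiset.card_replicate]
    · rw [Multiset.filter_eq_nil.2 fun P hP => (Multiset.eq_of_mem_replicate hP) ▸ h,
        Multiset.card_zero]

theorem card_multisetB [Finite F] {r : ℕ} (q j : ℕ) (a b : F) :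
    (multisetB q r j a b).card = Nat.card {P // P ∈ setB q r a b} + j := by
  classical
  rw [multisetB, Multiset.card_add, Multiset.card_replicate, ← Finset.card_def,
    ← Nat.card_eq_finsetCard]
  congr 1
  exact Nat.card_congr (Equiv.subtypeEquivRight fun P => by simp)

end Coordinates

/-! ### Intersection numbers of the multiset. -/

section Points

variable {K F : Type*} [Field K] [Field F] [Algebra K F]
  {a b : F} {e : F ≃ₗ[K] K × K} {τ : F →ₗ[K] K} {δ : F} (hδ : δ ≠ 0)
  (hy : ∀ y, y ^ Nat.card K - y = δ * algebraMap K F (τ y))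
  (hx : ∀ x, a ^ Nat.card K * x ^ (2 * Nat.card K) - a * x ^ 2
    - (b ^ Nat.card K - b) * x ^ (Nat.card K + 1) = δ * algebraMap K F ((e x).1 * (e x).2))

include hδ hy hx

theorem mem_setB_iff {m : ℕ} {P : ℙ F (Fin (m + 1 + 1) → F)} :
    P ∈ setB (Nat.card K) (m + 1) a b ↔
      ∃ x : (Fin m → F) × F, τ x.2 + hyperbolicSum e x.1 = 0 ∧ affinePoint x = P := by
  have key : ∀ x : (Fin m → F) × F, x.2 ^ Nat.card K - x.2
      + a ^ Nat.card K * ∑ i, x.1 i ^ (2 * Nat.card K) - a * ∑ i, x.1 i ^ 2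
      = (b ^ Nat.card K - b) * ∑ i, x.1 i ^ (Nat.card K + 1) ↔
      τ x.2 + hyperbolicSum e x.1 = 0 := fun x => by
    have h : a ^ Nat.card K * ∑ i, x.1 i ^ (2 * Nat.card K) - a * ∑ i, x.1 i ^ 2
        - (b ^ Nat.card K - b) * ∑ i, x.1 i ^ (Nat.card K + 1) =
        δ * algebraMap K F (hyperbolicSum e x.1) := by
      rw [hyperbolicSum, map_sum, Finset.mul_sum, Finset.mul_sum, Finset.mul_sum, Finset.mul_sum,
        ← Finset.sum_sub_distrib, ← Finset.sum_sub_distrib]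
      exact Finset.sum_congr rfl fun i _ => hx _
    have h' : δ * algebraMap K F (τ x.2 + hyperbolicSum e x.1) = 0 ↔
        τ x.2 + hyperbolicSum e x.1 = 0 := by
      rw [mul_eq_zero, or_iff_right hδ, map_eq_zero]
    rw [← h', map_add, mul_add, ← hy, ← h]
    constructor <;> intro h'' <;> linear_combination h''
  constructor
  · rintro ⟨x, hx0, rfl, h0, h⟩
    rw [sum_Ioo_zero_last, sum_Ioo_zero_last, sum_Ioo_zero_last] at h
    refine ⟨((coordEquiv F m).symm x).2, (key _).1 h, ?_⟩
    have : (1, ((coordEquiv F m).symm x).2) = (coordEquiv F m).symm x := Prod.ext h0.symm rfl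
    simp only [affinePoint, this, Equiv.apply_symm_apply]
  · rintro ⟨x, h, rfl⟩
    refine ⟨_, coordEquiv_one_ne_zero x, rfl, rfl, ?_⟩
    rw [sum_Ioo_zero_last, sum_Ioo_zero_last, sum_Ioo_zero_last]
    simpa using (key x).2 h

theorem card_setB_inter {m : ℕ} (p : ℙ F (Fin (m + 1 + 1) → F) → Prop) :
    Nat.card {P // P ∈ setB (Nat.card K) (m + 1) a b ∧ p P} =
      Nat.card {x : (Fin m → F) × F // τ x.2 + hyperbolicSum e x.1 = 0 ∧ p (affinePoint x)} := by
  symm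
  refine Nat.card_eq_of_bijective
    (fun x => ⟨affinePoint x.1, (mem_setB_iff hδ hy hx).2 ⟨x.1, x.2.1, rfl⟩, x.2.2⟩) ⟨?_, ?_⟩
  · intro x y h
    exact Subtype.ext (affinePoint_injective (congrArg Subtype.val h))
  · rintro ⟨P, hP, hp⟩
    obtain ⟨x, hx', rfl⟩ := (mem_setB_iff hδ hy hx).1 hP
    exact ⟨⟨x, hx', hp⟩, rfl⟩

theorem interNumber_coordEquiv [Finite F] {m : ℕ} (j : ℕ) (w₀ : F) (l : Fin m → F) (s : F)
    [Decidable (s = 0)] :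
    interNumber (multisetB (Nat.card K) (m + 1) j a b) (formKer (coordEquiv F m (w₀, l, s))) =
      Nat.card {x : (Fin m → F) × F // τ x.2 + hyperbolicSum e x.1 = 0 ∧
        w₀ + l ⬝ᵥ x.1 + s * x.2 = 0} + if s = 0 then j else 0 := by
  classical
  rw [interNumber_multisetB, card_setB_inter hδ hy hx]
  simp only [affinePoint_submodule_le_formKer, pointInfty_submodule_le_formKer]

variable [Finite K] [Finite F] (hτ : Function.Surjective τ) (hKF : Module.finrank K F = 2)

include hτ hKF

theorem card_multisetB_eq (m j : ℕ) :
    (multisetB (Nat.card K) (m + 1) j a b).card = Nat.card K ^ (2 * m + 1) + j := by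
  have h := card_setB_inter hδ hy hx (m := m) fun _ => True
  simp only [and_true] at h
  rw [card_multisetB, h, card_affine e τ hτ hKF]

/-- The sum of a function of the intersection number over all linear forms. -/
theorem sum_interNumber [Fintype F] {R : Type*} [AddCommMonoid R] (n j : ℕ) (f : ℕ → R) :
    ∑ w : Fin (n + 1 + 1 + 1) → F,
        f (interNumber (multisetB (Nat.card K) (n + 1 + 1) j a b) (formKer w)) =
      f (Nat.card K ^ (2 * n + 3) + j) + ((Nat.card K ^ 2 - 1) • f j +
      (Nat.card K ^ (2 * n + 4) - Nat.card K ^ 2) • f (Nat.card K ^ (2 * n + 1) + j) +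
      (Nat.card K ^ (2 * n + 3) * (Nat.card K ^ 2 - 1)) •
        f (Nat.card K ^ (2 * n + 1) - Nat.card K ^ n + Nat.card K ^ (n + 1)) +
      ((Nat.card K ^ (2 * n + 4) - Nat.card K ^ (2 * n + 3)) * (Nat.card K ^ 2 - 1)) •
        f (Nat.card K ^ (2 * n + 1) - Nat.card K ^ n)) := by
  classical
  have hI := interNumber_coordEquiv hδ hy hx (m := n + 1) j
  -- The kernel of the zero form is the whole space, so this term is the size of the multiset.
  have hzero : interNumber (multisetB (Nat.card K) (n + 1 + 1) j a b)
      (formKer (coordEquiv F (n + 1) (0, 0, 0))) = Nat.card K ^ (2 * n + 3) + j := by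
    rw [hI, if_pos rfl]
    simp only [zero_dotProduct, zero_mul, add_zero, and_true]
    rw [card_affine e τ hτ hKF]
    rfl
  rw [sum_coordEquiv, ← hzero]
  refine sum_by_position τ hτ hKF
    (fun l s => (shiftPair e τ (-s⁻¹ • l)).1 ⬝ᵥ (shiftPair e τ (-s⁻¹ • l)).2)
    (fun w₀ l s => f (interNumber _ (formKer (coordEquiv F (n + 1) (w₀, l, s))))) ?_ ?_ ?_ ?_
  · intro w₀ hw
    rw [hI, if_pos rfl]
    simp [hw]
  · intro w₀ l hl
    rw [hI, if_pos rfl, card_affine_inter_vertical e τ hτ hKF w₀ hl]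
  · intro w₀ l s hs h
    rw [hI, if_neg hs, card_affine_inter_nonvertical e τ w₀ l hs, if_pos h, add_zero]
  · intro w₀ l s hs h
    rw [hI, if_neg hs, card_affine_inter_nonvertical e τ w₀ l hs, if_neg h, add_zero, add_zero]

end Points

/-! ### Characters and counts of forms, with `n = r - 2`. -/

section Main

variable {K F : Type*} [Field K] [Finite K] [Field F] [Finite F] [Algebra K F]
  (hKF : Module.finrank K F = 2) {a b : F} (ha : a ≠ 0) (hb : b ∉ Set.range (algebraMap K F))
  (hab : DiscriminantCondition K (Nat.card K) a b)

include hKF ha hb hab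

theorem card_multisetB_of_discriminant (n j : ℕ) :
    (multisetB (Nat.card K) (n + 2) j a b).card = Nat.card K ^ (2 * n + 3) + j := by
  obtain ⟨e, τ, δ, hδ, hτ, hy, hx⟩ := exists_hyperbolic_coordinates hKF ha hb hab
  exact card_multisetB_eq hδ hy hx hτ hKF (n + 1) j

theorem sum_interNumber_of_discriminant [Fintype F] {R : Type*} [AddCommMonoid R] (n j : ℕ)
    (f : ℕ → R) :
    ∑ w : Fin (n + 2 + 1) → F,
        f (interNumber (multisetB (Nat.card K) (n + 2) j a b) (formKer w)) =
      f (Nat.card K ^ (2 * n + 3) + j) + ((Nat.card K ^ 2 - 1) • f j +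
      (Nat.card K ^ (2 * n + 4) - Nat.card K ^ 2) • f (Nat.card K ^ (2 * n + 1) + j) +
      (Nat.card K ^ (2 * n + 3) * (Nat.card K ^ 2 - 1)) •
        f (Nat.card K ^ (2 * n + 1) - Nat.card K ^ n + Nat.card K ^ (n + 1)) +
      ((Nat.card K ^ (2 * n + 4) - Nat.card K ^ (2 * n + 3)) * (Nat.card K ^ 2 - 1)) •
        f (Nat.card K ^ (2 * n + 1) - Nat.card K ^ n)) := by
  obtain ⟨e, τ, δ, hδ, hτ, hy, hx⟩ := exists_hyperbolic_coordinates hKF ha hb hab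
  exact sum_interNumber hδ hy hx hτ hKF n j f

open Classical in
/-- The number of nonzero linear forms whose kernel meets the multiset in `k` points. -/
theorem card_forms_interNumber_eq [Fintype F] (n j k : ℕ) :
    (Finset.univ.filter fun w : Fin (n + 2 + 1) → F => w ≠ 0 ∧
      interNumber (multisetB (Nat.card K) (n + 2) j a b) (formKer w) = k).card =
      (Nat.card K ^ 2 - 1) * (if j = k then 1 else 0) +
      (Nat.card K ^ (2 * n + 4) - Nat.card K ^ 2) *
        (if Nat.card K ^ (2 * n + 1) + j = k then 1 else 0) +
      (Nat.card K ^ (2 * n + 3) * (Nat.card K ^ 2 - 1)) *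
        (if Nat.card K ^ (2 * n + 1) - Nat.card K ^ n + Nat.card K ^ (n + 1) = k then 1 else 0) +
      ((Nat.card K ^ (2 * n + 4) - Nat.card K ^ (2 * n + 3)) * (Nat.card K ^ 2 - 1)) *
        (if Nat.card K ^ (2 * n + 1) - Nat.card K ^ n = k then 1 else 0) := by
  have h := sum_interNumber_of_discriminant hKF ha hb hab n j (fun i => if i = k then 1 else 0)
  have h0 : interNumber (multisetB (Nat.card K) (n + 2) j a b)
      (formKer (0 : Fin (n + 2 + 1) → F)) = Nat.card K ^ (2 * n + 3) + j := by
    rw [← card_multisetB_of_discriminant hKF ha hb hab, interNumber, Multiset.filter_eq_self.2]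
    intro P _ v _
    simp [mem_formKer]
  rw [Fintype.sum_eq_add_sum_compl (0 : Fin (n + 2 + 1) → F), h0, add_right_inj,
    Finset.sum_boole, Nat.cast_id] at h
  simp only [smul_eq_mul] at h
  rw [← h]
  congr 1
  ext w
  simp

/-- All four values occur because each coefficient in `card_forms_interNumber_eq` is positive when
`q > 1`. -/
theorem interNumbers_eq (n j : ℕ) :
    {k | ∃ w : Fin (n + 2 + 1) → F, w ≠ 0 ∧
      interNumber (multisetB (Nat.card K) (n + 2) j a b) (formKer w) = k} =
    {j, Nat.card K ^ (2 * n + 1) + j, Nat.card K ^ (2 * n + 1) - Nat.card K ^ n,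
      Nat.card K ^ (2 * n + 1) - Nat.card K ^ n + Nat.card K ^ (n + 1)} := by
  classical
  have := Fintype.ofFinite F
  ext k
  have h := card_forms_interNumber_eq hKF ha hb hab n j k
  have hq : 1 < Nat.card K := Finite.one_lt_card
  have h1 : 0 < Nat.card K ^ 2 - 1 := Nat.sub_pos_of_lt (Nat.one_lt_pow two_ne_zero hq)
  have h2 : 0 < Nat.card K ^ (2 * n + 4) - Nat.card K ^ 2 :=
    Nat.sub_pos_of_lt (Nat.pow_lt_pow_right hq (by omega))
  have h3 : 0 < Nat.card K ^ (2 * n + 4) - Nat.card K ^ (2 * n + 3) :=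
    Nat.sub_pos_of_lt (Nat.pow_lt_pow_right hq (by omega))
  have h4 : 0 < Nat.card K ^ (2 * n + 3) := Nat.pow_pos (by omega)
  have hiff : k ∈ {k | ∃ w : Fin (n + 2 + 1) → F, w ≠ 0 ∧
      interNumber (multisetB (Nat.card K) (n + 2) j a b) (formKer w) = k} ↔
      (Finset.univ.filter fun w : Fin (n + 2 + 1) → F => w ≠ 0 ∧
        interNumber (multisetB (Nat.card K) (n + 2) j a b) (formKer w) = k).card ≠ 0 := by
    rw [Finset.card_ne_zero]
    simp [Finset.Nonempty]
  rw [hiff, h]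
  simp only [ne_eq, Nat.add_eq_zero_iff, mul_eq_zero, h1.ne', h2.ne', h3.ne', h4.ne', false_or,
    or_self, ite_eq_right_iff, one_ne_zero, imp_false, Set.mem_insert_iff, Set.mem_singleton_iff]
  tauto

end Main

/-- The comparisons between the powers of `q` which occur as intersection numbers. -/
theorem power_comparisons {q : ℕ} (hq : 1 < q) (n : ℕ) :
    0 < q ^ n ∧ q ^ n < q ^ (n + 1) ∧ q ^ (n + 1) ≤ q ^ (2 * n + 1) ∧
      4 * q ^ (2 * n + 1) ≤ q ^ (2 * n + 3) := by
  refine ⟨Nat.pow_pos (by omega), Nat.pow_lt_pow_right hq (by omega),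
    Nat.pow_le_pow_right (by omega) (by omega), ?_⟩
  rw [show 2 * n + 3 = 2 + (2 * n + 1) by omega, pow_add q 2]
  exact Nat.mul_le_mul_right _ (Nat.pow_le_pow_left hq 2)

/-- Converts the number of forms of vertical hyperplanes into the number of those hyperplanes: all
hyperplanes through `P_∞` except the one at infinity. -/
theorem pow_sub_one_div_eq {q : ℕ} (hq : 1 < q) (n : ℕ) :
    q ^ (2 * n + 4) - q ^ 2 = (q ^ 2 - 1) * ((q ^ (2 * n + 4) - 1) / (q ^ 2 - 1) - 1) := by
  have h : q ^ 2 - 1 ∣ q ^ (2 * n + 4) - 1 := by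
    have := Nat.sub_dvd_pow_sub_pow (q ^ 2) 1 (n + 2)
    rwa [one_pow, ← pow_mul, show 2 * (n + 2) = 2 * n + 4 by ring] at this
  have h1 : 1 < q ^ 2 := Nat.one_lt_pow two_ne_zero hq
  rw [Nat.mul_sub, Nat.mul_div_cancel' h]
  omega

/-! ### Assembly of the three statements. -/

theorem mainTheorem4 {K F : Type*} [Field K] [Finite K] [Field F] [Finite F] [Algebra K F]
    (q r : ℕ) (hK : Nat.card K = q) (hKF : Module.finrank K F = 2)
    (hr : Even r) (hr2 : 2 ≤ r)
    (a b : F) (ha : a ≠ 0) (hb : b ∉ Set.range (algebraMap K F))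
    (hab : DiscriminantCondition K q a b) :
    -- the multiset and its code for an arbitrary multiplicity `j` of the point at infinity
    (∀ j : ℕ,
      (multisetB q r j a b).card = q ^ (2 * r - 1) + j ∧
      characters (multisetB q r j a b) =
        {j, q ^ (2 * r - 3) + j, q ^ (2 * r - 3) - q ^ (r - 2),
          q ^ (2 * r - 3) - q ^ (r - 2) + q ^ (r - 1)} ∧
      (∃ C : Submodule F (Fin (q ^ (2 * r - 1) + j) → F),
        IsCodeFrom (multisetB q r j a b) C) ∧
      ∀ (n : ℕ) (C : Submodule F (Fin n → F)), IsCodeFrom (multisetB q r j a b) C →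
        n = q ^ (2 * r - 1) + j ∧
        Module.finrank F C = r + 1 ∧
        nonzeroWeights C =
          {q ^ (2 * r - 1), q ^ (2 * r - 1) - q ^ (2 * r - 3),
            q ^ (2 * r - 1) - q ^ (2 * r - 3) + q ^ (r - 2) + j,
            q ^ (2 * r - 1) - q ^ (2 * r - 3) + q ^ (r - 2) + j - q ^ (r - 1)}) ∧
    -- the case `j = q ^ (r - 1) - q ^ (r - 2)`
    (∀ j : ℕ, j = q ^ (r - 1) - q ^ (r - 2) →
      (4 ≤ r →
        characters (multisetB q r j a b) =
          {q ^ (r - 1) - q ^ (r - 2), q ^ (2 * r - 3) - q ^ (r - 2) + q ^ (r - 1),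
            q ^ (2 * r - 3) - q ^ (r - 2)} ∧
        (characters (multisetB q r j a b)).ncard = 3 ∧
        hyperplaneCount (multisetB q r j a b) (q ^ (r - 1) - q ^ (r - 2)) = 1 ∧
        hyperplaneCount (multisetB q r j a b)
            (q ^ (2 * r - 3) - q ^ (r - 2) + q ^ (r - 1)) =
          (q ^ (2 * r) - 1) / (q ^ 2 - 1) - 1 + q ^ (2 * r - 1) ∧
        hyperplaneCount (multisetB q r j a b) (q ^ (2 * r - 3) - q ^ (r - 2)) =
          q ^ (2 * r) - q ^ (2 * r - 1)) ∧
      ∀ (n : ℕ) (C : Submodule F (Fin n → F)), IsCodeFrom (multisetB q r j a b) C →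
        weightEnumerator C =
          1 + (q ^ 2 - 1) • X ^ (q ^ (2 * r - 1))
            + (q ^ (2 * r) - q ^ 2 + q ^ (2 * r - 1) * (q ^ 2 - 1)) •
                X ^ (q ^ (2 * r - 1) - q ^ (2 * r - 3))
            + ((q ^ (2 * r) - q ^ (2 * r - 1)) * (q ^ 2 - 1)) •
                X ^ (q ^ (2 * r - 1) - q ^ (2 * r - 3) + q ^ (r - 1)) ∧
        (4 ≤ r →
          nonzeroWeights C =
            {q ^ (2 * r - 1), q ^ (2 * r - 1) - q ^ (2 * r - 3),
              q ^ (2 * r - 1) - q ^ (2 * r - 3) + q ^ (r - 1)} ∧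
          (nonzeroWeights C).ncard = 3)) ∧
    -- the case `j = q ^ (2 * r - 3) - q ^ (r - 2)`
    (∀ j : ℕ, j = q ^ (2 * r - 3) - q ^ (r - 2) →
      (4 ≤ r →
        characters (multisetB q r j a b) =
          {2 * q ^ (2 * r - 3) - q ^ (r - 2), q ^ (2 * r - 3) - q ^ (r - 2) + q ^ (r - 1),
            q ^ (2 * r - 3) - q ^ (r - 2)} ∧
        (characters (multisetB q r j a b)).ncard = 3 ∧
        hyperplaneCount (multisetB q r j a b) (2 * q ^ (2 * r - 3) - q ^ (r - 2)) =
          (q ^ (2 * r) - 1) / (q ^ 2 - 1) - 1 ∧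
        hyperplaneCount (multisetB q r j a b)
            (q ^ (2 * r - 3) - q ^ (r - 2) + q ^ (r - 1)) =
          q ^ (2 * r - 1) ∧
        hyperplaneCount (multisetB q r j a b) (q ^ (2 * r - 3) - q ^ (r - 2)) =
          q ^ (2 * r) - q ^ (2 * r - 1) + 1) ∧
      ∀ (n : ℕ) (C : Submodule F (Fin n → F)), IsCodeFrom (multisetB q r j a b) C →
        weightEnumerator C =
          1 + ((q ^ (2 * r) - q ^ (2 * r - 1) + 1) * (q ^ 2 - 1)) • X ^ (q ^ (2 * r - 1))
            + (q ^ (2 * r) - q ^ 2) • X ^ (q ^ (2 * r - 1) - q ^ (2 * r - 3))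
            + (q ^ (2 * r - 1) * (q ^ 2 - 1)) • X ^ (q ^ (2 * r - 1) - q ^ (r - 1)) ∧
        (4 ≤ r →
          nonzeroWeights C =
            {q ^ (2 * r - 1), q ^ (2 * r - 1) - q ^ (2 * r - 3),
              q ^ (2 * r - 1) - q ^ (r - 1)} ∧
          (nonzeroWeights C).ncard = 3)) := by
  subst hK
  obtain ⟨n, rfl⟩ : ∃ n, r = n + 2 := ⟨r - 2, by omega⟩
  have hq : 1 < Nat.card K := Finite.one_lt_card
  have hcardM := card_multisetB_of_discriminant hKF ha hb hab n
  have hset := interNumbers_eq hKF ha hb hab n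
  obtain ⟨hp₀, hp₁, hp₂, hp₃⟩ := power_comparisons hq n
  have hF : Nat.card F = Nat.card K ^ 2 := natCard_eq_sq hKF
  have hlt : ∀ (j : ℕ) (w : Fin (n + 2 + 1) → F), w ≠ 0 →
      interNumber (multisetB (Nat.card K) (n + 2) j a b) (formKer w) <
        (multisetB (Nat.card K) (n + 2) j a b).card := by
    intro j w hw
    have hmem := (hset j).subset ⟨w, hw, rfl⟩
    rw [hcardM]
    simp only [Set.mem_insert_iff, Set.mem_singleton_iff] at hmem
    omega
  have hcount : ∀ j k N : ℕ,
      (Nat.card K ^ 2 - 1) * (if j = k then 1 else 0) +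
      (Nat.card K ^ (2 * n + 4) - Nat.card K ^ 2) *
        (if Nat.card K ^ (2 * n + 1) + j = k then 1 else 0) +
      (Nat.card K ^ (2 * n + 3) * (Nat.card K ^ 2 - 1)) *
        (if Nat.card K ^ (2 * n + 1) - Nat.card K ^ n + Nat.card K ^ (n + 1) = k then 1 else 0) +
      ((Nat.card K ^ (2 * n + 4) - Nat.card K ^ (2 * n + 3)) * (Nat.card K ^ 2 - 1)) *
        (if Nat.card K ^ (2 * n + 1) - Nat.card K ^ n = k then 1 else 0) =
          (Nat.card K ^ 2 - 1) * N →
      hyperplaneCount (multisetB (Nat.card K) (n + 2) j a b) k = N := by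
    classical
    intro j k N h
    have := Fintype.ofFinite F
    refine Nat.eq_of_mul_eq_mul_left
      (Nat.sub_pos_of_lt (Nat.one_lt_pow two_ne_zero hq) : 0 < Nat.card K ^ 2 - 1) ?_
    rw [← h, ← card_forms_interNumber_eq hKF ha hb hab, ← card_sub_one_mul_hyperplaneCount, hF]
  have hchar : ∀ j, characters (multisetB (Nat.card K) (n + 2) j a b) =
      {j, Nat.card K ^ (2 * n + 1) + j, Nat.card K ^ (2 * n + 1) - Nat.card K ^ n,
        Nat.card K ^ (2 * n + 1) - Nat.card K ^ n + Nat.card K ^ (n + 1)} := fun j => by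
    rw [characters_eq, hset]
  have hweights : ∀ (j m : ℕ) (C : Submodule F (Fin m → F)),
      IsCodeFrom (multisetB (Nat.card K) (n + 2) j a b) C → nonzeroWeights C =
      {Nat.card K ^ (2 * n + 3), Nat.card K ^ (2 * n + 3) - Nat.card K ^ (2 * n + 1),
        Nat.card K ^ (2 * n + 3) - Nat.card K ^ (2 * n + 1) + Nat.card K ^ n + j,
        Nat.card K ^ (2 * n + 3) - Nat.card K ^ (2 * n + 1) + Nat.card K ^ n + j
          - Nat.card K ^ (n + 1)} := by
    intro j m C hC
    rw [nonzeroWeights_eq hC (hlt j), hset, Set.image_insert_eq, Set.image_insert_eq,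
      Set.image_pair, hcardM]
    congr 1
    · omega
    congr 1
    · omega
    congr 1
    · omega
    congr 1
    omega
  have henum : ∀ (j m : ℕ) (C : Submodule F (Fin m → F)),
      IsCodeFrom (multisetB (Nat.card K) (n + 2) j a b) C → weightEnumerator C =
      1 + ((Nat.card K ^ 2 - 1) • X ^ Nat.card K ^ (2 * n + 3) +
      (Nat.card K ^ (2 * n + 4) - Nat.card K ^ 2) •
        X ^ (Nat.card K ^ (2 * n + 3) - Nat.card K ^ (2 * n + 1)) +
      (Nat.card K ^ (2 * n + 3) * (Nat.card K ^ 2 - 1)) •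
        X ^ (Nat.card K ^ (2 * n + 3) - Nat.card K ^ (2 * n + 1) + Nat.card K ^ n + j
          - Nat.card K ^ (n + 1)) +
      ((Nat.card K ^ (2 * n + 4) - Nat.card K ^ (2 * n + 3)) * (Nat.card K ^ 2 - 1)) •
        X ^ (Nat.card K ^ (2 * n + 3) - Nat.card K ^ (2 * n + 1) + Nat.card K ^ n + j)) := by
    intro j m C hC
    have := Fintype.ofFinite F
    rw [weightEnumerator_eq_sum hC (hlt j), sum_interNumber_of_discriminant hKF ha hb hab n j
      fun k => (X : ℕ[X]) ^ ((multisetB (Nat.card K) (n + 2) j a b).card - k), hcardM]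
    have e₁ : Nat.card K ^ (2 * n + 3) + j - (Nat.card K ^ (2 * n + 1) + j) =
      Nat.card K ^ (2 * n + 3) - Nat.card K ^ (2 * n + 1) := by omega
    have e₂ : Nat.card K ^ (2 * n + 3) + j -
        (Nat.card K ^ (2 * n + 1) - Nat.card K ^ n + Nat.card K ^ (n + 1)) =
      Nat.card K ^ (2 * n + 3) - Nat.card K ^ (2 * n + 1) + Nat.card K ^ n + j
        - Nat.card K ^ (n + 1) := by omega
    have e₃ : Nat.card K ^ (2 * n + 3) + j - (Nat.card K ^ (2 * n + 1) - Nat.card K ^ n) =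
      Nat.card K ^ (2 * n + 3) - Nat.card K ^ (2 * n + 1) + Nat.card K ^ n + j := by omega
    rw [e₁, e₂, e₃, Nat.sub_self, Nat.add_sub_cancel, pow_zero]
  have hdiv := pow_sub_one_div_eq hq n
  -- These strict inequalities separate the three values. For `r = 2` one has `q ^ (n + 1) = q ^ (2
  -- * n + 1)`, and some of them coincide.
  have hstrict : 4 ≤ n + 2 →
      1 < Nat.card K ^ n ∧ Nat.card K ^ (n + 1) < Nat.card K ^ (2 * n + 1) := fun h =>
    ⟨Nat.one_lt_pow (by omega) hq, Nat.pow_lt_pow_right hq (by omega)⟩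
  rw [show 2 * (n + 2) - 1 = 2 * n + 3 by omega, show 2 * (n + 2) - 3 = 2 * n + 1 by omega,
    show 2 * (n + 2) = 2 * n + 4 by omega, show n + 2 - 1 = n + 1 by omega, Nat.add_sub_cancel]
  -- With the powers replaced by atoms, the comparisons between characters or weights become linear
  -- and fall to `omega`.
  generalize Nat.card K ^ (2 * n + 1) = S at *
  generalize Nat.card K ^ (2 * n + 3) = T at *
  generalize Nat.card K ^ (2 * n + 4) = U at *
  generalize Nat.card K ^ (n + 1) = v at *
  generalize Nat.card K ^ n = u at *
  refine ⟨fun j => ⟨hcardM j, hchar j, exists_isCodeFrom _ (hcardM j), fun m C hC =>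
    ⟨(card_eq_of_isCodeFrom hC).trans (hcardM j), finrank_of_isCodeFrom hC (hlt j),
      hweights j m C hC⟩⟩, ?_, ?_⟩
  · intro j hj
    -- This `j` gives vertical hyperplanes the same intersection number as tangent ones.
    have hjS : S + j = S - u + v := by omega
    refine ⟨fun hr4 => ?_, fun m C hC => ⟨?_, fun hr4 => ?_⟩⟩
    · obtain ⟨hu, hvS⟩ := hstrict hr4
      have hcj : characters (multisetB (Nat.card K) (n + 2) j a b) =
          {v - u, S - u + v, S - u} := by
        rw [hchar, hjS, hj]
        ext k
        simp only [Set.mem_insert_iff, Set.mem_singleton_iff]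
        tauto
      refine ⟨hcj, ?_, hcount _ _ _ ?_, hcount _ _ _ ?_, hcount _ _ _ ?_⟩
      · rw [hcj]
        exact Set.ncard_eq_three.2 ⟨_, _, _, by omega, by omega, by omega, rfl⟩
      · rw [if_pos hj, if_neg (by omega), if_neg (by omega), if_neg (by omega)]
        ring
      · rw [if_neg (by omega), if_pos hjS, if_pos rfl, if_neg (by omega), hdiv]
        ring
      · rw [if_neg (by omega), if_neg (by omega), if_neg (by omega), if_pos rfl]
        ring
    · rw [henum j m C hC, show T - S + u + j - v = T - S by omega,
        show T - S + u + j = T - S + v by omega, add_smul]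
      abel
    · obtain ⟨hu, hvS⟩ := hstrict hr4
      have hw : nonzeroWeights C = {T, T - S, T - S + v} := by
        rw [hweights j m C hC, show T - S + u + j - v = T - S by omega,
          show T - S + u + j = T - S + v by omega]
        ext k
        simp only [Set.mem_insert_iff, Set.mem_singleton_iff]
        tauto
      refine ⟨hw, ?_⟩
      rw [hw]
      exact Set.ncard_eq_three.2 ⟨_, _, _, by omega, by omega, by omega, rfl⟩
  · intro j hj
    -- Here the merger is different: `j = S - u` gives the hyperplane at infinity the intersection
    -- number of the secant ones, and vertical hyperplanes have `2 * S - u`.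
    have hjS : S + j = 2 * S - u := by omega
    refine ⟨fun hr4 => ?_, fun m C hC => ⟨?_, fun hr4 => ?_⟩⟩
    · obtain ⟨hu, hvS⟩ := hstrict hr4
      have hcj : characters (multisetB (Nat.card K) (n + 2) j a b) =
          {2 * S - u, S - u + v, S - u} := by
        rw [hchar, hjS, hj]
        ext k
        simp only [Set.mem_insert_iff, Set.mem_singleton_iff]
        tauto
      refine ⟨hcj, ?_, hcount _ _ _ ?_, hcount _ _ _ ?_, hcount _ _ _ ?_⟩
      · rw [hcj]
        exact Set.ncard_eq_three.2 ⟨_, _, _, by omega, by omega, by omega, rfl⟩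
      · rw [if_neg (by omega), if_pos hjS, if_neg (by omega), if_neg (by omega), hdiv]
        ring
      · rw [if_neg (by omega), if_neg (by omega), if_pos rfl, if_neg (by omega)]
        ring
      · rw [if_pos hj, if_neg (by omega), if_neg (by omega), if_pos rfl]
        ring
    · rw [henum j m C hC, show T - S + u + j - v = T - v by omega,
        show T - S + u + j = T by omega, add_mul, one_mul, add_smul]
      abel
    · obtain ⟨hu, hvS⟩ := hstrict hr4
      have hw : nonzeroWeights C = {T, T - S, T - v} := by
        rw [hweights j m C hC, show T - S + u + j - v = T - v by omega,
          show T - S + u + j = T by omega]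
        ext k
        simp only [Set.mem_insert_iff, Set.mem_singleton_iff]
        tauto
      refine ⟨hw, ?_⟩
      rw [hw]
      exact Set.ncard_eq_three.2 ⟨_, _, _, by omega, by omega, by omega, rfl⟩
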